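/- Let $d\ge 1$. Let $K_d\in[0,\infty]$ be the optimal constant in the Lieb--Thirring inequality, that is, the supremum of all real $K\ge 0$ such that for every $N\in\mathbb N$ and all complex-valued $u_1,\dots,u_N\in H^1(\mathbb R^d)$ that are orthonormal in $L^2(\mathbb R^d)$, $$\sum_{n=1}^N\int_{\mathbb R^d}|\nabla u_n|^2\,dx\;\ge\; K\int_{\mathbb R^d}\Big(\sum_{n=1}^N|u_n|^2\Big)^{1+\frac2d}dx .$$ Then $$K_d\;\le\; K_d^{\mathrm{cl}}:=\frac{d}{d+2}\,\frac{(2\pi)^2}{\omega_d^{2/d}},$$ where $\omega_d$ is the Lebesgue measure of the unit ball in $\mathbb R^d$. -/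

import Mathlib

open MeasureTheory
open scoped NNReal ENNReal ContDiff

noncomputable section

namespace LiebThirring

/-- `g` is the weak gradient of `u` on `ℝᵈ`: for every real test function `φ ∈ C_c^∞(ℝᵈ)` and every
coordinate `j` one has `∫ (∂_j φ) u = - ∫ φ g_j`. Since `u` and `g` are square integrable, both
integrals converge. In other words, `u` lies in the complex Sobolev space `H¹(ℝᵈ)` and `∇u = g`. -/
def IsWeakGradient {d : ℕ}
    (u : Lp ℂ 2 (volume : Measure (EuclideanSpace ℝ (Fin d))))
    (g : Lp (EuclideanSpace ℂ (Fin d)) 2 (volume : Measure (EuclideanSpace ℝ (Fin d)))) : Prop :=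
  ∀ φ : EuclideanSpace ℝ (Fin d) → ℝ, ContDiff ℝ ∞ φ → HasCompactSupport φ → ∀ j : Fin d,
    ∫ x, ((fderiv ℝ φ x (EuclideanSpace.single j 1) : ℝ) : ℂ) * u x
      = - ∫ x, ((φ x : ℝ) : ℂ) * g x j

/-- The Lieb–Thirring inequality in dimension `d` holds with the constant `K`: for every `N` and all
`u₁, …, u_N ∈ H¹(ℝᵈ)` that are orthonormal in `L²(ℝᵈ)`,
`∑ ∫ |∇uₙ|² ≥ K ∫ (∑ |uₙ|²)^(1 + 2/d)`. All integrands are nonnegative and the integrals take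
values in `[0, ∞]`. -/
def HoldsWith (d : ℕ) (K : ℝ≥0) : Prop :=
  ∀ (N : ℕ)
    (u : Fin N → Lp ℂ 2 (volume : Measure (EuclideanSpace ℝ (Fin d))))
    (g : Fin N → Lp (EuclideanSpace ℂ (Fin d)) 2 (volume : Measure (EuclideanSpace ℝ (Fin d)))),
    (∀ n, IsWeakGradient (u n) (g n)) → Orthonormal ℂ u →
      (K : ℝ≥0∞) * ∫⁻ x, (∑ n, ‖u n x‖ₑ ^ 2) ^ (1 + 2 / (d : ℝ))
        ≤ ∑ n, ∫⁻ x, ‖g n x‖ₑ ^ 2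

/-- The optimal Lieb–Thirring constant `K_d`: the supremum, in `[0, ∞]`, of all constants with which
the Lieb–Thirring inequality in dimension `d` holds. -/
def optimalConstant (d : ℕ) : ℝ≥0∞ :=
  ⨆ (K : ℝ≥0) (_ : HoldsWith d K), (K : ℝ≥0∞)

/-- The classical constant `K_d^cl = (d / (d + 2)) (2π)² / ω_d^(2/d)`, where `ω_d` is the Lebesgue
measure of the unit ball of `ℝᵈ`. -/
def classicalConstant (d : ℕ) : ℝ :=
  (d : ℝ) / ((d : ℝ) + 2) *
    ((2 * Real.pi) ^ 2 /
      (volume.real (Metric.ball (0 : EuclideanSpace ℝ (Fin d)) 1)) ^ (2 / (d : ℝ)))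

end LiebThirring

end

noncomputable section

namespace LiebThirring

open Filter Topology Pointwise

variable {d : ℕ}

/-! The inequality is tested on Dirichlet eigenfunctions of the unit cube, extended by zero, with
frequencies `k` in the positive orthant and `|k| < n`. They are orthonormal with kinetic energy `π²
|k|²`. The density of `N` such functions has mass `N` and vanishes off a set of measure one, so
Jensen bounds its `(1 + 2/d)`-integral below by `N ^ (1 + 2/d)`; no pointwise control of the density
is needed. This gives `K N ^ (1 + 2/d) ≤ π² ∑ |k|²` (`HoldsWith.card_rpow_le`).

Riemann sums over the orthant part of the ball (`tendsto_sum_positiveLatticeBall`) give `N ~ 2⁻ᵈ ω_d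
nᵈ` and `∑ |k|² ~ 2⁻ᵈ ω_d d/(d+2) nᵈ⁺²`. The powers of `n` cancel, and the limit is the classical
constant. -/

/-! ### One-dimensional Dirichlet modes -/

/-- The normalized Dirichlet mode `√2 sin(π k t)` of `[0, 1]`, extended by zero. -/
def sinMode (k : ℤ) : ℝ → ℝ :=
  (Set.Icc 0 1).indicator fun t => √2 * Real.sin (Real.pi * k * t)

/-- The derivative `√2 π k cos(π k t)` of `sinMode k` on `[0, 1]`, extended by zero. -/
def cosMode (k : ℤ) : ℝ → ℝ :=
  (Set.Icc 0 1).indicator fun t => √2 * (Real.pi * k * Real.cos (Real.pi * k * t))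

/-- The sine vanishes at both endpoints, so extending by zero agrees with clamping the argument to
`[0, 1]`. Clamping is Lipschitz, unlike the indicator. -/
lemma sinMode_eq_projIcc (k : ℤ) (t : ℝ) :
    sinMode k t = √2 * Real.sin (Real.pi * k * (Set.projIcc (0 : ℝ) 1 zero_le_one t : ℝ)) := by
  by_cases ht : t ∈ Set.Icc (0 : ℝ) 1
  · rw [sinMode, Set.indicator_of_mem ht, Set.projIcc_of_mem _ ht]
  · rw [sinMode, Set.indicator_of_notMem ht]
    rcases lt_or_ge t 0 with h0 | h0
    · simp [Set.projIcc_of_le_left zero_le_one h0.le]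
    · have h1 : 1 ≤ t := by
        by_contra! h
        exact ht ⟨h0, h.le⟩
      simp [Set.projIcc_of_right_le zero_le_one h1, mul_comm Real.pi, Real.sin_int_mul_pi]

lemma measurable_sinMode (k : ℤ) : Measurable (sinMode k) :=
  Measurable.indicator (by fun_prop) measurableSet_Icc

lemma measurable_cosMode (k : ℤ) : Measurable (cosMode k) :=
  Measurable.indicator (by fun_prop) measurableSet_Icc

lemma memLp_indicator_Icc {f : ℝ → ℝ} (hf : Continuous f) :
    MemLp ((Set.Icc (0 : ℝ) 1).indicator f) 2 := by
  rw [memLp_indicator_iff_restrict measurableSet_Icc]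
  obtain ⟨C, hC⟩ := isCompact_Icc.exists_bound_of_continuousOn (s := Set.Icc (0 : ℝ) 1)
    hf.continuousOn
  exact MemLp.of_bound hf.aestronglyMeasurable C
    ((ae_restrict_mem measurableSet_Icc).mono hC)

lemma memLp_sinMode (k : ℤ) : MemLp (sinMode k) 2 := memLp_indicator_Icc (by fun_prop)

lemma memLp_cosMode (k : ℤ) : MemLp (cosMode k) 2 := memLp_indicator_Icc (by fun_prop)

lemma hasDerivAt_sinMode (k : ℤ) {t : ℝ} (h0 : t ≠ 0) (h1 : t ≠ 1) :
    HasDerivAt (sinMode k) (cosMode k t) t := by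
  by_cases ht : t ∈ Set.Icc (0 : ℝ) 1
  · have hnhds : Set.Icc (0 : ℝ) 1 ∈ nhds t :=
      Icc_mem_nhds (lt_of_le_of_ne ht.1 h0.symm) (lt_of_le_of_ne ht.2 h1)
    rw [cosMode, Set.indicator_of_mem ht]
    have h : HasDerivAt (fun t : ℝ => √2 * Real.sin (Real.pi * k * t))
        (√2 * (Real.pi * k * Real.cos (Real.pi * k * t))) t := by
      have := (((hasDerivAt_id t).const_mul (Real.pi * k)).sin).const_mul √2
      simpa [mul_comm, mul_left_comm, mul_assoc] using this
    refine h.congr_of_eventuallyEq ?_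
    filter_upwards [hnhds] with s hs
    rw [sinMode, Set.indicator_of_mem hs]
  · rw [cosMode, Set.indicator_of_notMem ht]
    refine (hasDerivAt_const t (0 : ℝ)).congr_of_eventuallyEq ?_
    filter_upwards [isClosed_Icc.isOpen_compl.mem_nhds ht] with s hs
    rw [sinMode, Set.indicator_of_notMem hs]

lemma integral_cos_pi_int_mul {m : ℤ} (hm : m ≠ 0) :
    ∫ t in (0 : ℝ)..1, Real.cos (Real.pi * m * t) = 0 := by
  have hc : Real.pi * m ≠ 0 := mul_ne_zero Real.pi_ne_zero (by exact_mod_cast hm)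
  rw [intervalIntegral.integral_comp_mul_left (fun x => Real.cos x) hc]
  simp [mul_comm Real.pi, Real.sin_int_mul_pi]

lemma integral_indicator_Icc_mul (f g : ℝ → ℝ) :
    ∫ t, (Set.Icc (0 : ℝ) 1).indicator f t * (Set.Icc (0 : ℝ) 1).indicator g t
      = ∫ t in (0 : ℝ)..1, f t * g t := by
  simp_rw [← Set.indicator_mul]
  rw [integral_indicator measurableSet_Icc, intervalIntegral.integral_of_le zero_le_one,
    integral_Icc_eq_integral_Ioc]

lemma integral_sinMode_mul_sinMode {k l : ℤ} (hk : 0 < k) (hl : 0 < l) :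
    ∫ t, sinMode k t * sinMode l t = if k = l then 1 else 0 := by
  have hpt : ∀ t : ℝ, √2 * Real.sin (Real.pi * k * t) * (√2 * Real.sin (Real.pi * l * t))
      = Real.cos (Real.pi * (k - l : ℤ) * t) - Real.cos (Real.pi * (k + l : ℤ) * t) := by
    intro t
    have h1 : Real.pi * (k - l : ℤ) * t = Real.pi * k * t - Real.pi * l * t := by
      push_cast; ring
    have h2 : Real.pi * (k + l : ℤ) * t = Real.pi * k * t + Real.pi * l * t := by
      push_cast; ring
    rw [h1, h2, Real.cos_sub, Real.cos_add]
    linear_combination Real.sin (Real.pi * k * t) * Real.sin (Real.pi * l * t) *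
      Real.mul_self_sqrt (zero_le_two : (0 : ℝ) ≤ 2)
  unfold sinMode
  rw [integral_indicator_Icc_mul]
  simp_rw [hpt]
  -- Positive frequencies make `k + l` nonzero, so only the `k - l` term can survive.
  rw [intervalIntegral.integral_sub (Continuous.intervalIntegrable (by fun_prop) _ _)
    (Continuous.intervalIntegrable (by fun_prop) _ _),
    integral_cos_pi_int_mul (m := k + l) (by omega), sub_zero]
  split_ifs with h
  · simp [h]
  · rw [integral_cos_pi_int_mul (by omega)]

lemma integral_cosMode_mul_cosMode {k : ℤ} (hk : 0 < k) :
    ∫ t, cosMode k t * cosMode k t = Real.pi ^ 2 * (k : ℝ) ^ 2 := by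
  have hpt : ∀ t : ℝ, √2 * (Real.pi * k * Real.cos (Real.pi * k * t)) *
      (√2 * (Real.pi * k * Real.cos (Real.pi * k * t)))
      = Real.pi ^ 2 * k ^ 2 * (1 + Real.cos (Real.pi * (2 * k : ℤ) * t)) := by
    intro t
    have h1 : Real.pi * (2 * k : ℤ) * t = 2 * (Real.pi * k * t) := by
      push_cast; ring
    rw [h1, Real.cos_two_mul]
    linear_combination (Real.pi * k * Real.cos (Real.pi * k * t)) ^ 2 *
      Real.mul_self_sqrt (zero_le_two : (0 : ℝ) ≤ 2)
  unfold cosMode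
  rw [integral_indicator_Icc_mul]
  simp_rw [hpt]
  rw [intervalIntegral.integral_const_mul, intervalIntegral.integral_add
    (Continuous.intervalIntegrable (by fun_prop) _ _)
    (Continuous.intervalIntegrable (by fun_prop) _ _), integral_cos_pi_int_mul (by omega)]
  simp

/-! ### Dirichlet eigenfunctions of the cube -/

/-- The tensor product of `d` functions of one variable, as a function on `ℝᵈ`. -/
def tensor (f : Fin d → ℝ → ℝ) (x : EuclideanSpace ℝ (Fin d)) : ℝ := ∏ i, f i (x i)

lemma tensor_mul_tensor (f g : Fin d → ℝ → ℝ) (x : EuclideanSpace ℝ (Fin d)) :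
    tensor f x * tensor g x = tensor (fun i t => f i t * g i t) x :=
  Finset.prod_mul_distrib.symm

lemma integral_tensor (f : Fin d → ℝ → ℝ) : ∫ x, tensor f x = ∏ i, ∫ t, f i t := by
  rw [← (PiLp.volume_preserving_toLp (Fin d)).integral_comp
    (MeasurableEquiv.toLp 2 (Fin d → ℝ)).measurableEmbedding]
  exact integral_fintype_prod_volume_eq_prod f

lemma integrable_tensor {f : Fin d → ℝ → ℝ} (hf : ∀ i, Integrable (f i)) :
    Integrable (tensor f) := by
  rw [← (PiLp.volume_preserving_toLp (Fin d)).integrable_comp_emb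
    (MeasurableEquiv.toLp 2 (Fin d → ℝ)).measurableEmbedding]
  exact Integrable.fintype_prod hf

lemma measurable_tensor {f : Fin d → ℝ → ℝ} (hf : ∀ i, Measurable (f i)) :
    Measurable (tensor f) :=
  Finset.measurable_fun_prod _ fun i _ => (hf i).comp (by fun_prop)

lemma memLp_tensor {f : Fin d → ℝ → ℝ} (hm : ∀ i, Measurable (f i)) (hf : ∀ i, MemLp (f i) 2) :
    MemLp (tensor f) 2 := by
  rw [memLp_two_iff_integrable_sq (measurable_tensor hm).aestronglyMeasurable]
  simp_rw [sq, tensor_mul_tensor]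
  exact integrable_tensor fun i => by simpa [sq] using (hf i).integrable_sq

/-- The unit cube `[0, 1]ᵈ`. -/
def unitCube (d : ℕ) : Set (EuclideanSpace ℝ (Fin d)) :=
  {x | ∀ i, x i ∈ Set.Icc (0 : ℝ) 1}

lemma unitCube_eq_preimage :
    unitCube d = (WithLp.ofLp : EuclideanSpace ℝ (Fin d) → Fin d → ℝ) ⁻¹'
      Set.univ.pi fun _ => Set.Icc (0 : ℝ) 1 := by
  ext x
  simp only [unitCube, Set.mem_ofPred_eq, Set.mem_preimage, Set.mem_univ_pi]

lemma isCompact_unitCube : IsCompact (unitCube d) := by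
  rw [unitCube_eq_preimage]
  exact (PiLp.homeomorph 2 (fun _ : Fin d => ℝ)).isCompact_preimage.2
    (isCompact_univ_pi fun _ => isCompact_Icc)

lemma volume_unitCube : volume (unitCube d) = 1 := by
  rw [unitCube_eq_preimage, (PiLp.volume_preserving_ofLp (Fin d)).measure_preimage
    (MeasurableSet.univ_pi fun _ => measurableSet_Icc).nullMeasurableSet, volume_pi_pi]
  simp

/-- The Dirichlet eigenfunction of the unit cube with frequencies `k`, extended by zero. -/
def mode (k : Fin d → ℤ) : EuclideanSpace ℝ (Fin d) → ℝ := tensor fun i => sinMode (k i)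

/-- The `j`-th partial derivative of `mode k`. -/
def modeDeriv (k : Fin d → ℤ) (j : Fin d) : EuclideanSpace ℝ (Fin d) → ℝ :=
  tensor fun i => if i = j then cosMode (k i) else sinMode (k i)

lemma mode_eq_zero (k : Fin d → ℤ) {x : EuclideanSpace ℝ (Fin d)} (hx : x ∉ unitCube d) :
    mode k x = 0 := by
  simp only [unitCube, Set.mem_ofPred_eq, not_forall] at hx
  obtain ⟨i, hi⟩ := hx
  exact Finset.prod_eq_zero (Finset.mem_univ i) (Set.indicator_of_notMem hi _)

lemma memLp_mode (k : Fin d → ℤ) : MemLp (mode k) 2 :=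
  memLp_tensor (fun _ => measurable_sinMode _) fun _ => memLp_sinMode _

lemma memLp_modeDeriv (k : Fin d → ℤ) (j : Fin d) : MemLp (modeDeriv k j) 2 := by
  refine memLp_tensor (fun i => ?_) fun i => ?_
  · split_ifs
    exacts [measurable_cosMode _, measurable_sinMode _]
  · split_ifs
    exacts [memLp_cosMode _, memLp_sinMode _]

lemma hasCompactSupport_mode (k : Fin d → ℤ) : HasCompactSupport (mode k) :=
  HasCompactSupport.intro isCompact_unitCube fun _ hx => mode_eq_zero k hx

/-- A product of sines is `C¹`, hence Lipschitz on the compact convex cube; clamping every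
coordinate is 1-Lipschitz from the Euclidean to the sup distance. -/
lemma exists_lipschitzWith_mode (k : Fin d → ℤ) : ∃ C, LipschitzWith C (mode k) := by
  let P : (Fin d → ℝ) → ℝ := fun y => ∏ i, √2 * Real.sin (Real.pi * k i * y i)
  have hP : ContDiff ℝ 1 P := by fun_prop
  obtain ⟨C, hC⟩ := hP.contDiffOn.exists_lipschitzOnWith one_ne_zero
    (convex_pi (s := Set.univ) fun _ _ => convex_Icc (0 : ℝ) 1)
    (isCompact_univ_pi fun _ => isCompact_Icc)
  let proj : EuclideanSpace ℝ (Fin d) → Fin d → ℝ :=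
    fun x i => (Set.projIcc (0 : ℝ) 1 zero_le_one (x i) : ℝ)
  have hproj : LipschitzWith 1 proj := by
    have h1 : LipschitzWith 1 fun t : ℝ => (Set.projIcc (0 : ℝ) 1 zero_le_one t : ℝ) := by
      simpa [Function.comp_def] using
        (LipschitzWith.subtype_val _).comp (LipschitzWith.projIcc (zero_le_one (α := ℝ)))
    refine LipschitzWith.of_edist_le fun x y => ?_
    rw [edist_pi_le_iff]
    intro i
    calc edist (proj x i) (proj y i) ≤ edist (x i) (y i) := by simpa using h1 (x i) (y i)
      _ ≤ edist x.ofLp y.ofLp := edist_le_pi_edist _ _ i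
      _ ≤ edist x y := by
        simpa using PiLp.lipschitzWith_ofLp 2 (fun _ : Fin d => ℝ) x y
  refine ⟨C * 1, ?_⟩
  have h : mode k = P ∘ proj := by
    funext x
    simp only [mode, tensor, sinMode_eq_projIcc, Function.comp_apply, P, proj]
  rw [h, ← lipschitzOnWith_univ]
  exact hC.comp (lipschitzOnWith_univ.2 hproj) fun x _ i _ => Subtype.coe_prop _

lemma hasLineDerivAt_mode (k : Fin d → ℤ) (j : Fin d) {x : EuclideanSpace ℝ (Fin d)}
    (h0 : x j ≠ 0) (h1 : x j ≠ 1) :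
    HasLineDerivAt ℝ (mode k) (modeDeriv k j x) x (EuclideanSpace.single j 1) := by
  have hderiv : HasDerivAt (fun t : ℝ => sinMode (k j) (x j + t)) (cosMode (k j) (x j)) 0 := by
    have := (hasDerivAt_sinMode (k j) h0 h1)
    rw [← add_zero (x j)] at this
    simpa using this.comp_const_add (x j) 0
  have hprod := hderiv.mul_const (∏ i ∈ Finset.univ.erase j, sinMode (k i) (x i))
  have hval : modeDeriv k j x
      = cosMode (k j) (x j) * ∏ i ∈ Finset.univ.erase j, sinMode (k i) (x i) := by
    rw [modeDeriv, tensor, ← Finset.mul_prod_erase _ _ (Finset.mem_univ j), if_pos rfl]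
    congr 1
    exact Finset.prod_congr rfl fun i hi => by rw [if_neg (Finset.ne_of_mem_erase hi)]
  rw [HasLineDerivAt, hval]
  refine hprod.congr_of_eventuallyEq (.of_forall fun t => ?_)
  dsimp only
  rw [mode, tensor, ← Finset.mul_prod_erase _ _ (Finset.mem_univ j)]
  congr 1
  · simp
  · exact Finset.prod_congr rfl fun i hi => by simp [Finset.ne_of_mem_erase hi]

lemma ae_coord_ne (j : Fin d) (a : ℝ) : ∀ᵐ x : EuclideanSpace ℝ (Fin d), x j ≠ a :=
  (PiLp.volume_preserving_ofLp (Fin d)).quasiMeasurePreserving.ae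
    (Measure.ae_eval_ne (μ := fun _ : Fin d => (volume : Measure ℝ)) j a)

/-- Integration by parts needs only Lipschitz functions, one of them compactly supported. The kinks
in direction `j` lie on the null hyperplanes `x j = 0` and `x j = 1`. -/
lemma integral_fderiv_mul_mode (k : Fin d → ℤ) (j : Fin d) {φ : EuclideanSpace ℝ (Fin d) → ℝ}
    (hφ : ContDiff ℝ ∞ φ) (hc : HasCompactSupport φ) :
    ∫ x, fderiv ℝ φ x (EuclideanSpace.single j 1) * mode k x = -∫ x, φ x * modeDeriv k j x := by
  obtain ⟨C, hC⟩ := exists_lipschitzWith_mode k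
  obtain ⟨D, hD⟩ := ContDiff.lipschitzWith_of_hasCompactSupport hc hφ (by simp)
  have h := LipschitzWith.integral_lineDeriv_mul_eq (μ := volume) hD hC (hasCompactSupport_mode k)
    (EuclideanSpace.single j 1)
  have hl : ∀ x, lineDeriv ℝ φ x (EuclideanSpace.single j 1)
      = fderiv ℝ φ x (EuclideanSpace.single j 1) := fun x =>
    ((hφ.differentiable (by simp)).differentiableAt).lineDeriv_eq_fderiv
  simp_rw [hl] at h
  rw [h, ← integral_neg]
  refine integral_congr_ae ?_
  filter_upwards [ae_coord_ne j 0, ae_coord_ne j 1] with x h0 h1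
  rw [lineDeriv_neg, (hasLineDerivAt_mode k j h0 h1).lineDeriv]
  ring

lemma integral_mode_mul_mode {k l : Fin d → ℤ} (hk : ∀ i, 0 < k i) (hl : ∀ i, 0 < l i) :
    ∫ x, mode k x * mode l x = if k = l then 1 else 0 := by
  simp_rw [mode, tensor_mul_tensor, integral_tensor,
    fun i => integral_sinMode_mul_sinMode (hk i) (hl i)]
  rw [Finset.prod_ite_zero]
  simp [funext_iff]

lemma integral_modeDeriv_mul_modeDeriv {k : Fin d → ℤ} (hk : ∀ i, 0 < k i) (j : Fin d) :
    ∫ x, modeDeriv k j x * modeDeriv k j x = Real.pi ^ 2 * (k j : ℝ) ^ 2 := by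
  simp_rw [modeDeriv, tensor_mul_tensor, integral_tensor]
  rw [← Finset.mul_prod_erase _ _ (Finset.mem_univ j), Finset.prod_eq_one, mul_one]
  · simpa using integral_cosMode_mul_cosMode (hk j)
  · intro i hi
    simpa [Finset.ne_of_mem_erase hi] using integral_sinMode_mul_sinMode (hk i) (hk i)

/-! ### The modes in complex `L²` -/

/-- `mode k` as an element of the complex `L²` space. -/
def modeLp (k : Fin d → ℤ) : Lp ℂ 2 (volume : Measure (EuclideanSpace ℝ (Fin d))) :=
  ((memLp_mode k).ofReal (K := ℂ)).toLp _

lemma coeFn_modeLp (k : Fin d → ℤ) : ∀ᵐ x, modeLp k x = (mode k x : ℂ) :=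
  MemLp.coeFn_toLp _

lemma memLp_modeGrad (k : Fin d → ℤ) :
    MemLp (fun x => (WithLp.toLp 2 fun j => (modeDeriv k j x : ℂ) : EuclideanSpace ℂ (Fin d))) 2
      (volume : Measure (EuclideanSpace ℝ (Fin d))) :=
  MemLp.of_eval_piLp fun j => (memLp_modeDeriv k j).ofReal (K := ℂ)

/-- The gradient of `mode k` as an element of `L²`. -/
def modeGradLp (k : Fin d → ℤ) :
    Lp (EuclideanSpace ℂ (Fin d)) 2 (volume : Measure (EuclideanSpace ℝ (Fin d))) :=
  (memLp_modeGrad k).toLp _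

lemma coeFn_modeGradLp (k : Fin d → ℤ) :
    ∀ᵐ x, modeGradLp k x = WithLp.toLp 2 fun j => (modeDeriv k j x : ℂ) :=
  MemLp.coeFn_toLp _

lemma isWeakGradient_modeLp (k : Fin d → ℤ) : IsWeakGradient (modeLp k) (modeGradLp k) := by
  intro φ hφ hc j
  have h1 : ∫ x, ((fderiv ℝ φ x (EuclideanSpace.single j 1) : ℝ) : ℂ) * modeLp k x
      = ∫ x, ((fderiv ℝ φ x (EuclideanSpace.single j 1) * mode k x : ℝ) : ℂ) := by
    refine integral_congr_ae ?_
    filter_upwards [coeFn_modeLp k] with x hx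
    rw [hx, Complex.ofReal_mul]
  have h2 : ∫ x, ((φ x : ℝ) : ℂ) * modeGradLp k x j
      = ∫ x, ((φ x * modeDeriv k j x : ℝ) : ℂ) := by
    refine integral_congr_ae ?_
    filter_upwards [coeFn_modeGradLp k] with x hx
    rw [hx, Complex.ofReal_mul]
  rw [h1, h2, integral_complex_ofReal, integral_complex_ofReal, integral_fderiv_mul_mode k j hφ hc,
    Complex.ofReal_neg]

lemma inner_modeLp {k l : Fin d → ℤ} (hk : ∀ i, 0 < k i) (hl : ∀ i, 0 < l i) :
    inner ℂ (modeLp k) (modeLp l) = if k = l then 1 else 0 := by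
  have h : ∫ x, inner ℂ (modeLp k x) (modeLp l x) = ∫ x, ((mode k x * mode l x : ℝ) : ℂ) := by
    refine integral_congr_ae ?_
    filter_upwards [coeFn_modeLp k, coeFn_modeLp l] with x hx hx'
    simp [hx, hx', mul_comm]
  rw [L2.inner_def, h, integral_complex_ofReal, integral_mode_mul_mode hk hl]
  split_ifs <;> simp

lemma lintegral_enorm_modeLp_sq {k : Fin d → ℤ} (hk : ∀ i, 0 < k i) :
    ∫⁻ x, ‖modeLp k x‖ₑ ^ 2 = 1 := by
  have h : ∫⁻ x, ‖modeLp k x‖ₑ ^ 2 = ∫⁻ x, ENNReal.ofReal (mode k x * mode k x) := by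
    refine lintegral_congr_ae ?_
    filter_upwards [coeFn_modeLp k] with x hx
    rw [hx, ← ofReal_norm, ← ENNReal.ofReal_pow (norm_nonneg _), Complex.norm_real,
      Real.norm_eq_abs, sq_abs, sq]
  rw [h, ← ofReal_integral_eq_lintegral_ofReal, integral_mode_mul_mode hk hk, if_pos rfl,
    ENNReal.ofReal_one]
  · simpa [sq] using (memLp_mode k).integrable_sq
  · exact .of_forall fun x => mul_self_nonneg _

lemma lintegral_enorm_modeGradLp_sq {k : Fin d → ℤ} (hk : ∀ i, 0 < k i) :
    ∫⁻ x, ‖modeGradLp k x‖ₑ ^ 2 = ENNReal.ofReal (Real.pi ^ 2 * ∑ j, (k j : ℝ) ^ 2) := by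
  have h : ∫⁻ x, ‖modeGradLp k x‖ₑ ^ 2
      = ∫⁻ x, ENNReal.ofReal (∑ j, modeDeriv k j x * modeDeriv k j x) := by
    refine lintegral_congr_ae ?_
    filter_upwards [coeFn_modeGradLp k] with x hx
    rw [hx, ← ofReal_norm, ← ENNReal.ofReal_pow (norm_nonneg _),
      EuclideanSpace.norm_sq_eq]
    simp [sq]
  have hint : ∀ j ∈ Finset.univ, Integrable fun x => modeDeriv k j x * modeDeriv k j x :=
    fun j _ => by simpa [sq] using (memLp_modeDeriv k j).integrable_sq
  rw [h, ← ofReal_integral_eq_lintegral_ofReal (integrable_finsetSum _ hint)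
    (.of_forall fun x => Finset.sum_nonneg fun j _ => mul_self_nonneg _),
    integral_finsetSum _ hint]
  simp_rw [integral_modeDeriv_mul_modeDeriv hk, Finset.mul_sum]

/-! ### Jensen's inequality and the test with finitely many modes -/

/-- Jensen's inequality for the `p`-th power of a function that vanishes off a set of measure
one. -/
lemma lintegral_rpow_le_of_support {α : Type*} [MeasurableSpace α] {μ : Measure α} {s : Set α}
    (hs : MeasurableSet s) (hμ : μ s = 1) {f : α → ℝ≥0∞} (hf : AEMeasurable f μ)
    (h0 : ∀ᵐ x ∂μ, x ∉ s → f x = 0) {p : ℝ} (hp : 1 ≤ p) :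
    (∫⁻ x, f x ∂μ) ^ p ≤ ∫⁻ x, f x ^ p ∂μ := by
  have hprob : IsProbabilityMeasure (μ.restrict s) := ⟨by rw [Measure.restrict_apply_univ, hμ]⟩
  have hp0 : 0 < p := zero_lt_one.trans_le hp
  have hsupp : ∫⁻ x, f x ∂μ = ∫⁻ x in s, f x ∂μ := by
    rw [← lintegral_indicator hs]
    refine lintegral_congr_ae ?_
    filter_upwards [h0] with x hx
    by_cases hxs : x ∈ s
    · rw [Set.indicator_of_mem hxs]
    · rw [Set.indicator_of_notMem hxs, hx hxs]
  -- On a probability space the `L¹` norm is at most the `Lᵖ` norm.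
  have h := eLpNorm'_le_eLpNorm'_of_exponent_le one_pos hp (μ.restrict s)
    hf.restrict.aestronglyMeasurable
  simp only [eLpNorm', enorm_eq_self, ENNReal.rpow_one, div_one] at h
  calc (∫⁻ x, f x ∂μ) ^ p ≤ ((∫⁻ x in s, f x ^ p ∂μ) ^ (1 / p)) ^ p := by
        rw [hsupp]
        exact ENNReal.rpow_le_rpow h hp0.le
    _ = ∫⁻ x in s, f x ^ p ∂μ := by
        rw [← ENNReal.rpow_mul, one_div, inv_mul_cancel₀ hp0.ne', ENNReal.rpow_one]
    _ ≤ ∫⁻ x, f x ^ p ∂μ := setLIntegral_le_lintegral _ _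

/-- The Lieb–Thirring inequality tested on Dirichlet eigenfunctions of the unit cube. -/
lemma HoldsWith.card_rpow_le {K : ℝ≥0} (hK : HoldsWith d K) (T : Finset (Fin d → ℤ))
    (hT : ∀ k ∈ T, ∀ i, 0 < k i) :
    (K : ℝ) * (T.card : ℝ) ^ (1 + 2 / (d : ℝ))
      ≤ Real.pi ^ 2 * ∑ k ∈ T, ∑ i, (k i : ℝ) ^ 2 := by
  let e : Fin T.card → Fin d → ℤ := fun n => (T.equivFin.symm n : Fin d → ℤ)
  have he : ∀ n i, 0 < e n i := fun n => hT _ (T.equivFin.symm n).2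
  have horth : Orthonormal ℂ fun n => modeLp (e n) := by
    rw [orthonormal_iff_ite]
    intro m n
    rw [inner_modeLp (he m) (he n)]
    simp [e]
  have hp : (1 : ℝ) ≤ 1 + 2 / (d : ℝ) := by
    have : (0 : ℝ) ≤ 2 / d := by positivity
    linarith
  have hmeas : ∀ n, AEMeasurable (fun x => ‖modeLp (e n) x‖ₑ ^ 2)
      (volume : Measure (EuclideanSpace ℝ (Fin d))) := fun n =>
    ((Lp.aestronglyMeasurable _).enorm).pow_const 2
  have hmass : ∫⁻ x, ∑ n, ‖modeLp (e n) x‖ₑ ^ 2 = T.card := by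
    rw [lintegral_finsetSum' _ fun n _ => hmeas n]
    simp [lintegral_enorm_modeLp_sq (he _)]
  have hzero : ∀ᵐ x, x ∉ unitCube d → ∑ n, ‖modeLp (e n) x‖ₑ ^ 2 = 0 := by
    filter_upwards [ae_all_iff.2 fun n => coeFn_modeLp (e n)] with x hx hxs
    simp [hx, mode_eq_zero _ hxs]
  have hjensen := lintegral_rpow_le_of_support isCompact_unitCube.measurableSet volume_unitCube
    (Finset.aemeasurable_fun_sum Finset.univ fun n _ => hmeas n) hzero hp
  rw [hmass] at hjensen
  have h := (mul_le_mul_right hjensen (K : ℝ≥0∞)).trans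
    (hK T.card _ _ (fun n => isWeakGradient_modeLp (e n)) horth)
  have hsum : ∑ n, ∫⁻ x, ‖modeGradLp (e n) x‖ₑ ^ 2
      = ENNReal.ofReal (Real.pi ^ 2 * ∑ k ∈ T, ∑ i, (k i : ℝ) ^ 2) := by
    simp_rw [lintegral_enorm_modeGradLp_sq (he _)]
    rw [← ENNReal.ofReal_sum_of_nonneg fun n _ => by positivity, ← Finset.mul_sum,
      ← Finset.sum_coe_sort T,
      ← Equiv.sum_comp T.equivFin.symm fun k : T => ∑ i, ((k : Fin d → ℤ) i : ℝ) ^ 2]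
  rw [hsum, ← ENNReal.ofReal_coe_nnreal, ← ENNReal.ofReal_natCast,
    ENNReal.ofReal_rpow_of_nonneg (Nat.cast_nonneg _) (by positivity),
    ← ENNReal.ofReal_mul K.coe_nonneg, ENNReal.ofReal_le_ofReal_iff (by positivity)] at h
  exact h

/-! ### Moments of the ball in the positive orthant -/

lemma volume_preimage_abs (s : Set ℝ) :
    volume ((fun t : ℝ => |t|) ⁻¹' s) = 2 * volume (s ∩ Set.Ioi 0) := by
  have hpos : (fun t : ℝ => |t|) ⁻¹' s ∩ Set.Ioi 0 = s ∩ Set.Ioi 0 := by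
    ext t
    simp only [Set.mem_inter_iff, Set.mem_preimage, Set.mem_Ioi, and_congr_left_iff]
    intro ht
    rw [abs_of_pos ht]
  have hneg : (fun t : ℝ => |t|) ⁻¹' s ∩ Set.Iio 0 = Neg.neg ⁻¹' (s ∩ Set.Ioi 0) := by
    ext t
    simp only [Set.mem_inter_iff, Set.mem_preimage, Set.mem_Ioi, Set.mem_Iio, neg_pos,
      and_congr_left_iff]
    intro ht
    rw [abs_of_neg ht]
  have hdiff : ((fun t : ℝ => |t|) ⁻¹' s \ Set.Ioi 0 : Set ℝ)
      =ᵐ[volume] ((fun t : ℝ => |t|) ⁻¹' s ∩ Set.Iio 0 : Set ℝ) := by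
    rw [Set.sdiff_eq, Set.compl_Ioi]
    exact (ae_eq_refl _).inter Iio_ae_eq_Iic.symm
  rw [← measure_inter_add_sdiff _ (measurableSet_Ioi (a := (0 : ℝ))), measure_congr hdiff, hpos,
    hneg, Measure.measure_preimage_neg, two_mul]

/-- Coordinatewise absolute value folds the `2ᵈ` orthants onto one. A product measure is determined
on boxes, where the claim is one-dimensional. -/
lemma restrict_orthant_eq_smul_map_abs :
    (volume : Measure (Fin d → ℝ)).restrict (Set.univ.pi fun _ => Set.Ioi 0)
      = ((2 : ℝ≥0∞) ^ d)⁻¹ • (volume : Measure (Fin d → ℝ)).map fun x i => |x i| := by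
  rw [volume_pi, Measure.restrict_pi_pi]
  refine Measure.pi_eq fun s hs => ?_
  have hmeas : Measurable fun (x : Fin d → ℝ) i => |x i| := by fun_prop
  have hpre : (fun (x : Fin d → ℝ) i => |x i|) ⁻¹' Set.univ.pi s
      = Set.univ.pi fun i => (fun t : ℝ => |t|) ⁻¹' s i := by
    ext x
    simp
  rw [Measure.smul_apply, Measure.map_apply hmeas (MeasurableSet.univ_pi hs), hpre,
    Measure.pi_pi]
  simp_rw [volume_preimage_abs, Measure.restrict_apply (hs _)]
  rw [Finset.prod_mul_distrib, Finset.prod_const, Finset.card_univ, Fintype.card_fin,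
    smul_eq_mul, ← mul_assoc, ENNReal.inv_mul_cancel (by simp) (by simp), one_mul]

lemma setIntegral_orthant_of_even {f : (Fin d → ℝ) → ℝ} (hf : Measurable f)
    (heven : ∀ x, f (fun i => |x i|) = f x) :
    ∫ x in Set.univ.pi fun _ => Set.Ioi 0, f x = ((2 : ℝ) ^ d)⁻¹ * ∫ x, f x := by
  rw [restrict_orthant_eq_smul_map_abs, integral_smul_measure,
    integral_map (Measurable.aemeasurable (by fun_prop)) hf.aestronglyMeasurable]
  simp [heven]

/-- The part of the open Euclidean unit ball in the positive orthant. -/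
def positiveBall (d : ℕ) : Set (Fin d → ℝ) :=
  (Set.univ.pi fun _ => Set.Ioi 0) ∩ {x | ∑ i, x i ^ 2 < 1}

lemma measurableSet_positiveBall : MeasurableSet (positiveBall d) :=
  (MeasurableSet.univ_pi fun _ => measurableSet_Ioi).inter
    (measurableSet_lt (by fun_prop) measurable_const)

lemma isBounded_positiveBall : Bornology.IsBounded (positiveBall d) := by
  refine (Metric.isBounded_closedBall (x := (0 : Fin d → ℝ)) (r := 1)).subset fun x hx => ?_
  rw [mem_closedBall_zero_iff, pi_norm_le_iff_of_nonneg zero_le_one]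
  intro i
  rw [Real.norm_eq_abs, ← sq_le_one_iff_abs_le_one]
  exact (Finset.single_le_sum (f := fun i => x i ^ 2) (fun i _ => sq_nonneg _)
    (Finset.mem_univ i)).trans hx.2.le

/-- Convexity makes the frontier null, as the Riemann sum limit requires. -/
lemma convex_positiveBall : Convex ℝ (positiveBall d) := by
  refine (convex_pi fun _ _ => convex_Ioi 0).inter ?_
  have h : {x : Fin d → ℝ | ∑ i, x i ^ 2 < 1} = (EuclideanSpace.equiv (Fin d) ℝ).symm ⁻¹'
      Metric.ball (0 : EuclideanSpace ℝ (Fin d)) 1 := by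
    ext x
    rw [Set.mem_preimage, mem_ball_zero_iff, ← sq_lt_one_iff₀ (norm_nonneg _),
      EuclideanSpace.real_norm_sq_eq]
    rfl
  rw [h]
  exact (convex_ball _ _).linear_preimage
    (EuclideanSpace.equiv (Fin d) ℝ).symm.toLinearEquiv.toLinearMap

/-- By evenness this is `2⁻ᵈ` times the integral over the ball, which polar coordinates reduce to `d
ω_d ∫₀¹ r ^ (d - 1 + 2m) dr`. -/
lemma setIntegral_positiveBall (hd : 1 ≤ d) (m : ℕ) :
    ∫ x in positiveBall d, (∑ i, x i ^ 2) ^ m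
      = ((2 : ℝ) ^ d)⁻¹ * (d * volume.real (Metric.ball (0 : EuclideanSpace ℝ (Fin d)) 1)
        / (d + 2 * m)) := by
  have hball : MeasurableSet {x : Fin d → ℝ | ∑ i, x i ^ 2 < 1} :=
    measurableSet_lt (by fun_prop) measurable_const
  have hradial : ∫ x : Fin d → ℝ,
      {x : Fin d → ℝ | ∑ i, x i ^ 2 < 1}.indicator (fun x => (∑ i, x i ^ 2) ^ m) x
      = ∫ x : EuclideanSpace ℝ (Fin d), (Set.Iio (1 : ℝ)).indicator (fun r => r ^ (2 * m)) ‖x‖ := by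
    rw [← (PiLp.volume_preserving_ofLp (Fin d)).integral_comp
      (MeasurableEquiv.toLp 2 (Fin d → ℝ)).symm.measurableEmbedding]
    refine integral_congr_ae (.of_forall fun x => ?_)
    have hx : ∑ i, x i ^ 2 = ‖x‖ ^ 2 := (EuclideanSpace.real_norm_sq_eq x).symm
    simp only [Set.indicator_apply, Set.mem_ofPred_eq, Set.mem_Iio, hx, pow_mul,
      sq_lt_one_iff₀ (norm_nonneg x)]
  have hpow : ∫ y in Set.Ioi (0 : ℝ),
      y ^ (d - 1) • (Set.Iio (1 : ℝ)).indicator (fun r => r ^ (2 * m)) y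
      = ((d : ℝ) + 2 * m)⁻¹ := by
    have hfun : ∀ y : ℝ, y ^ (d - 1) • (Set.Iio (1 : ℝ)).indicator (fun r => r ^ (2 * m)) y
        = (Set.Iio (1 : ℝ)).indicator (fun r => r ^ (d - 1 + 2 * m)) y := by
      intro y
      by_cases hy : y ∈ Set.Iio (1 : ℝ)
      · rw [Set.indicator_of_mem hy, Set.indicator_of_mem hy, smul_eq_mul, pow_add]
      · rw [Set.indicator_of_notMem hy, Set.indicator_of_notMem hy, smul_zero]
    simp_rw [hfun]
    rw [setIntegral_indicator measurableSet_Iio, Set.Ioi_inter_Iio, ← integral_Ioc_eq_integral_Ioo,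
      ← intervalIntegral.integral_of_le zero_le_one, integral_pow, one_pow,
      zero_pow (by omega), sub_zero, one_div]
    congr 1
    push_cast [Nat.cast_sub hd]
    ring
  have : Nonempty (Fin d) := ⟨⟨0, hd⟩⟩
  rw [positiveBall, ← setIntegral_indicator hball, setIntegral_orthant_of_even
    (Measurable.indicator (by fun_prop) hball) (fun x => by simp [Set.indicator_apply]), hradial,
    integral_fun_norm_addHaar, finrank_euclideanSpace_fin, hpow, nsmul_eq_mul, smul_eq_mul]
  ring

/-! ### Lattice point asymptotics -/

/-- The lattice points with positive coordinates in the open Euclidean ball of radius `n`. -/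
def positiveLatticeBall (d n : ℕ) : Finset (Fin d → ℤ) :=
  (Fintype.piFinset fun _ => Finset.Ioo (0 : ℤ) n).filter fun k => ∑ i, k i ^ 2 < (n : ℤ) ^ 2

/-- The box in the definition only ensures finiteness: the ball condition already forces `k i < n`.
-/
lemma mem_positiveLatticeBall {n : ℕ} {k : Fin d → ℤ} :
    k ∈ positiveLatticeBall d n ↔ (∀ i, 0 < k i) ∧ ∑ i, k i ^ 2 < (n : ℤ) ^ 2 := by
  simp only [positiveLatticeBall, Finset.mem_filter, Fintype.mem_piFinset, Finset.mem_Ioo]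
  refine ⟨fun h => ⟨fun i => (h.1 i).1, h.2⟩, fun h => ⟨fun i => ⟨h.1 i, ?_⟩, h.2⟩⟩
  refine lt_of_pow_lt_pow_left₀ 2 (Int.natCast_nonneg n) (lt_of_le_of_lt ?_ h.2)
  exact Finset.single_le_sum (f := fun i => k i ^ 2) (fun i _ => sq_nonneg _) (Finset.mem_univ i)

lemma div_mem_positiveBall_iff {n : ℕ} (hn : n ≠ 0) (k : Fin d → ℤ) :
    (fun i => (k i : ℝ) / n) ∈ positiveBall d ↔ k ∈ positiveLatticeBall d n := by
  have hn' : (0 : ℝ) < n := by positivity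
  rw [mem_positiveLatticeBall, positiveBall, Set.mem_inter_iff, Set.mem_univ_pi]
  refine and_congr (forall_congr' fun i => ?_) ?_
  · rw [Set.mem_Ioi, div_pos_iff_of_pos_right hn', Int.cast_pos]
  · simp_rw [Set.mem_ofPred_eq, div_pow]
    rw [← Finset.sum_div, div_lt_one (by positivity)]
    exact_mod_cast Iff.rfl

/-- These are Riemann sums on the grid `n⁻¹ ℤᵈ`. The case `m = 0` counts the modes and `m = 1` gives
their energy. -/
lemma tendsto_sum_positiveLatticeBall (hd : 1 ≤ d) (m : ℕ) :
    Tendsto (fun n : ℕ => (∑ k ∈ positiveLatticeBall d n, (∑ i, ((k i : ℝ) / n) ^ 2) ^ m)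
        / (n : ℝ) ^ d) atTop
      (𝓝 (((2 : ℝ) ^ d)⁻¹ * (d * volume.real (Metric.ball (0 : EuclideanSpace ℝ (Fin d)) 1)
        / (d + 2 * m)))) := by
  have h := tendsto_tsum_div_pow_atTop_integral (positiveBall d)
    (fun x => (∑ i, x i ^ 2) ^ m) (by fun_prop) isBounded_positiveBall
    measurableSet_positiveBall (convex_positiveBall.addHaar_frontier volume)
  rw [setIntegral_positiveBall hd] at h
  refine h.congr' ?_
  filter_upwards [eventually_ne_atTop 0] with n hn
  have : NeZero n := ⟨hn⟩
  have hn' : (n : ℝ) ≠ 0 := by positivity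
  rw [Fintype.card_fin]
  congr 1
  have hset : positiveBall d ∩ (n : ℝ)⁻¹ •
        (Submodule.span ℤ (Set.range (Pi.basisFun ℝ (Fin d))) : Set (Fin d → ℝ))
      = (positiveLatticeBall d n).image fun k i => (k i : ℝ) / n := by
    ext x
    rw [Set.mem_inter_iff, ← Submodule.coe_pointwise_smul, SetLike.mem_coe,
      BoxIntegral.unitPartition.mem_smul_span_iff,
      Finset.coe_image, Set.mem_image]
    constructor
    · rintro ⟨hx, hL⟩
      choose k hk using hL
      have hxk : (fun i => (k i : ℝ) / n) = x := by
        funext i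
        have hi : (k i : ℝ) = n * x i := hk i
        rw [hi, mul_div_cancel_left₀ _ hn']
      refine ⟨k, ?_, hxk⟩
      rw [Finset.mem_coe, ← div_mem_positiveBall_iff hn, hxk]
      exact hx
    · rintro ⟨k, hk, rfl⟩
      refine ⟨(div_mem_positiveBall_iff hn k).2 hk, fun i => ⟨k i, ?_⟩⟩
      rw [mul_div_cancel₀ _ hn']
      rfl
  have hinj : Function.Injective fun (k : Fin d → ℤ) i => (k i : ℝ) / n := by
    intro k l hkl
    funext i
    have hi : (k i : ℝ) / n = l i / n := congrFun hkl i
    exact_mod_cast (div_left_inj' hn').1 hi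
  rw [hset, Finset.tsum_subtype' _ fun x : Fin d → ℝ => (∑ i, x i ^ 2) ^ m,
    Finset.sum_image hinj.injOn]

/-! ### Passage to the limit -/

lemma HoldsWith.coe_le_classicalConstant (hd : 1 ≤ d) {K : ℝ≥0} (hK : HoldsWith d K) :
    (K : ℝ) ≤ classicalConstant d := by
  set v := volume.real (Metric.ball (0 : EuclideanSpace ℝ (Fin d)) 1) with hv
  have hv0 : 0 < v :=
    ENNReal.toReal_pos (Metric.measure_ball_pos _ _ one_pos).ne' measure_ball_lt_top.ne
  have hd0 : (0 : ℝ) < d := by exact_mod_cast hd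
  have hp : (0 : ℝ) < 1 + 2 / (d : ℝ) := by positivity
  have hcard := tendsto_sum_positiveLatticeBall hd 0
  have hsum := tendsto_sum_positiveLatticeBall hd 1
  simp only [pow_zero, Finset.sum_const, nsmul_eq_mul, mul_one, Nat.cast_zero, mul_zero, add_zero,
    mul_div_cancel_left₀ _ hd0.ne'] at hcard
  simp only [pow_one, Nat.cast_one, mul_one] at hsum
  rw [← hv] at hcard hsum
  have hlim := le_of_tendsto_of_tendsto ((hcard.rpow_const (Or.inr hp.le)).const_mul (K : ℝ))
    (hsum.const_mul (Real.pi ^ 2)) (by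
      filter_upwards [eventually_gt_atTop 0] with n hn
      have hn' : (0 : ℝ) < n := by exact_mod_cast hn
      have h := hK.card_rpow_le (positiveLatticeBall d n)
        fun k hk => (mem_positiveLatticeBall.1 hk).1
      -- Both sides of the tested inequality scale like `nᵈ⁺²`.
      have hpow : ((n : ℝ) ^ d) ^ (1 + 2 / (d : ℝ)) = (n : ℝ) ^ 2 * (n : ℝ) ^ d := by
        rw [← Real.rpow_natCast, ← Real.rpow_mul hn'.le, mul_add, mul_div_cancel₀ _ hd0.ne',
          mul_one, Real.rpow_add hn', mul_comm, Real.rpow_two]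
      rw [Real.div_rpow (Nat.cast_nonneg _) (by positivity), hpow]
      simp_rw [div_pow, ← Finset.sum_div]
      rw [div_div, ← mul_div_assoc, ← mul_div_assoc]
      gcongr)
  -- This orthant factor turns `π²` into `(2π)²`.
  have hquarter : (((2 : ℝ) ^ d)⁻¹) ^ (2 / (d : ℝ)) = 4⁻¹ := by
    rw [Real.inv_rpow (by positivity), ← Real.rpow_natCast, ← Real.rpow_mul zero_le_two,
      mul_div_cancel₀ _ hd0.ne']
    norm_num
  have hv2 : 0 < v ^ (2 / (d : ℝ)) := Real.rpow_pos_of_pos hv0 _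
  rw [Real.rpow_add (by positivity), Real.rpow_one,
    Real.mul_rpow (by positivity) hv0.le, hquarter] at hlim
  have h2 : (0 : ℝ) < ((2 : ℝ) ^ d)⁻¹ * v := by positivity
  have hcancel : (K : ℝ) * (4⁻¹ * v ^ (2 / (d : ℝ))) ≤ Real.pi ^ 2 * (d / (d + 2)) := by
    refine le_of_mul_le_mul_left ?_ h2
    calc _ = (K : ℝ) * (((2 : ℝ) ^ d)⁻¹ * v * (4⁻¹ * v ^ (2 / (d : ℝ)))) := by ring
      _ ≤ _ := hlim
      _ = _ := by ring
  rw [classicalConstant, ← hv, ← mul_div_assoc, le_div_iff₀ hv2]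
  linarith

end LiebThirring

end

theorem mainTheorem9 (d : ℕ) (hd : 1 ≤ d) :
    LiebThirring.optimalConstant d ≤ ENNReal.ofReal (LiebThirring.classicalConstant d) := by
  refine iSup₂_le fun K hK => ?_
  rw [← ENNReal.ofReal_coe_nnreal]
  exact ENNReal.ofReal_le_ofReal (hK.coe_le_classicalConstant hd)
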